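/- Write $r=|x|$ for $x\in\mathbb{R}^2$. Let $$\mathcal{G}=\mathbb{R}^4\setminus\Big\{\Big(x,-\frac{x}{|x|^2}\Big): x\in\mathbb{R}^2\setminus\{0\}\Big\}\subseteq\mathbb{R}^2\times\mathbb{R}^2,$$ an open subset of $\mathbb{R}^4$, and let $\varphi(x,a)=(x,\,x+|x|^2a)$, which restricts to a bijection (in fact a diffeomorphism) from $\mathcal{G}\setminus(\{0\}\times\mathbb{R}^2)$ onto $(\mathbb{R}^2\setminus\{0\})\times(\mathbb{R}^2\setminus\{0\})$. Equip the latter with the structure of the pair groupoid over $\mathbb{R}^2\setminus\{0\}$, with $s(x,y)=y$, $t(x,y)=x$, $(x,y)\cdot(y,z)=(x,z)$. **Theorem.** There is one and only one Lie groupoid structure $\mathcal{G}\rightrightarrows\mathbb{R}^2$ whose structure maps extend those of the pair groupoid of $\mathbb{R}^2\setminus\{0\}$, pulled back to $\mathcal{G}\setminus(\{0\}\times\mathbb{R}^2)$ along $\varphi$. Its source and target maps are $s(x,a)=x+|x|^2a$ and $t(x,a)=x$. The Lie algebroid of $\mathcal{G}$ (the kernel of $ds$ along the units, with anchor $dt$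 and the bracket of right-invariant vector fields) is isomorphic to $\mathrm{span}(r^2\partial_{x_1},r^2\partial_{x_2})$, the Lie algebroid whose sections are the vector fields $r^2V$ with $V$ a smooth vector field on $\mathbb{R}^2$, with the bracket of vector fields and the inclusion as anchor. Moreover, $\mathcal{G}$ integrates the cotangent Lie algebroid of every elliptic Poisson structure on $(\mathbb{R}^2,\{0\})$ (these all have nonzero elliptic residue). That is: let $\mathcal{A}_{|D|}$ be the elliptic tangent bundle, whose sections are the smooth vector fields on $\mathbb{R}^2$ that preserve the ideal generated by $r^2$, let $\rho:\mathcal{A}_{|D|}\to T\mathbb{R}^2$ be its anchor, let $\omega\in\Gamma(\Lambda^2\mathcal{A}_{|D|}^*)$ be nondegenerate and closed, and let $\pi$ be the Poisson structure on $\mathbb{R}^2$ with $\pi^\sharp=\rho\circ(\omega^\flat)^{-1}\circ\rho^*$. Then the Lie algebroid of $\mathcal{G}$ is isomorphic to $(T^*\mathbb{R}^2,\pi^\sharp,[\cdot,\cdot]_\pi)$. -/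

import Mathlib

open scoped ContDiff

noncomputable section

namespace EllipticGroupoid

/-! ### Lie groupoids with an open subset of a normed space as arrows -/

/-- A function on a subset `S` of a normed space is smooth on `S`; the value of the extension
outside `S` is irrelevant. -/
def SmoothOnSubset {E F : Type*} [NormedAddCommGroup E] [NormedSpace ℝ E]
    [NormedAddCommGroup F] [NormedSpace ℝ F] (S : Set E) (f : S → F) : Prop :=
  ContDiffOn ℝ ∞ (Function.extend Subtype.val f 0) S

/-- The differential of a function defined on an open subset `S` of a normed space. -/
def differential {E F : Type*} [NormedAddCommGroup E] [NormedSpace ℝ E]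
    [NormedAddCommGroup F] [NormedSpace ℝ F] {S : Set E} (f : S → F) (g : S) : E →L[ℝ] F :=
  fderiv ℝ (Function.extend Subtype.val f 0) (g : E)

/-- A Lie groupoid `G ⇉ B`, where the manifold of arrows is an open subset `G` of a normed space
`E` and the manifold of objects is a normed space `B`. The product `mul g h` is defined when
`src g = tgt h`, as in `(x, y) (y, z) = (x, z)` with `src (x, y) = y` and `tgt (x, y) = x`. -/
structure LieGroupoid {E : Type*} [NormedAddCommGroup E] [NormedSpace ℝ E] (G : Set E)
    (B : Type*) [NormedAddCommGroup B] [NormedSpace ℝ B] where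
  isOpen_arrows : IsOpen G
  src : G → B
  tgt : G → B
  unit : B → G
  inv : G → G
  mul : (g h : G) → src g = tgt h → G
  src_unit : ∀ x, src (unit x) = x
  tgt_unit : ∀ x, tgt (unit x) = x
  src_inv : ∀ g : G, src (inv g) = tgt g
  tgt_inv : ∀ g : G, tgt (inv g) = src g
  src_mul : ∀ (g h : G) (e : src g = tgt h), src (mul g h e) = src h
  tgt_mul : ∀ (g h : G) (e : src g = tgt h), tgt (mul g h e) = tgt g
  unit_mul : ∀ g : G, mul (unit (tgt g)) g (src_unit _) = g
  mul_unit : ∀ g : G, mul g (unit (src g)) (tgt_unit _).symm = g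
  mul_assoc : ∀ (g h k : G) (e : src g = tgt h) (e' : src h = tgt k),
    mul (mul g h e) k ((src_mul g h e).trans e') = mul g (mul h k e') (e.trans (tgt_mul h k e').symm)
  inv_mul : ∀ g : G, mul (inv g) g (src_inv g) = unit (src g)
  mul_inv : ∀ g : G, mul g (inv g) (tgt_inv g).symm = unit (tgt g)
  smooth_src : SmoothOnSubset G src
  smooth_tgt : SmoothOnSubset G tgt
  smooth_unit : ContDiff ℝ ∞ (fun x => (unit x : E))
  smooth_inv : SmoothOnSubset G (fun g => (inv g : E))
  smooth_mul : ∃ μ : E × E → E,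
    ContDiffOn ℝ ∞ μ {p | ∃ g h : G, src g = tgt h ∧ p = ((g : E), (h : E))} ∧
      ∀ (g h : G) (e : src g = tgt h), μ ((g : E), (h : E)) = mul g h e
  submersion_src : ∀ g : G, Function.Surjective (differential src g)
  submersion_tgt : ∀ g : G, Function.Surjective (differential tgt g)

namespace LieGroupoid

variable {E : Type*} [NormedAddCommGroup E] [NormedSpace ℝ E] {G : Set E}
  {B : Type*} [NormedAddCommGroup B] [NormedSpace ℝ B]

/-- `X` is a smooth right-invariant vector field on the arrows: it is tangent to the source fibres,
and right multiplication by `h`, a map between source fibres, sends `X g` to `X (g h)`. The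
differential of right multiplication is expressed by its action on curves in a source fibre. -/
def IsRightInvariant (𝒢 : LieGroupoid G B) (X : E → E) : Prop :=
  ContDiffOn ℝ ∞ X G ∧
  (∀ g : G, differential 𝒢.src g (X g) = 0) ∧
  ∀ (g h : G) (e : 𝒢.src g = 𝒢.tgt h) (γ : ℝ → G) (hγ : ∀ τ, 𝒢.src (γ τ) = 𝒢.tgt h),
    γ 0 = g → HasDerivAt (fun τ => (γ τ : E)) (X g) 0 →
      HasDerivAt (fun τ => (𝒢.mul (γ τ) h (hγ τ) : E)) (X (𝒢.mul g h e)) 0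

/-- The fibre at `x` of the Lie algebroid of `𝒢`: the kernel of the differential of the source map
at the unit arrow of `x`. -/
def algebroidFibre (𝒢 : LieGroupoid G B) (x : B) : Submodule ℝ E :=
  LinearMap.ker (differential 𝒢.src (𝒢.unit x)).toLinearMap

/-- The anchor of the Lie algebroid of `𝒢`: the differential of the target map (restricted to
`algebroidFibre 𝒢 x`). -/
def algebroidAnchor (𝒢 : LieGroupoid G B) (x : B) : E →L[ℝ] B :=
  differential 𝒢.tgt (𝒢.unit x)

/-- `U` is the bracket, in the Lie algebroid of `𝒢`, of the sections `V` and `W`: the restriction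
to the units of the Lie bracket of the right-invariant vector fields extending `V` and `W`. -/
def IsAlgebroidBracket (𝒢 : LieGroupoid G B) (V W U : B → E) : Prop :=
  ∃ X Y : E → E, 𝒢.IsRightInvariant X ∧ 𝒢.IsRightInvariant Y ∧
    (∀ x, X (𝒢.unit x) = V x) ∧ (∀ x, Y (𝒢.unit x) = W x) ∧
    ∀ x, U x = VectorField.lieBracket ℝ X Y (𝒢.unit x)

/-- `𝒢` integrates the Lie algebroid on the trivial bundle `B × A → B` with the given anchor and
the given bracket of sections: there is an isomorphism `Φ` of vector bundles over the identity of
`B`, from `B × A` to the Lie algebroid of `𝒢`, that respects anchors and brackets. -/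
def Integrates {A : Type*} [NormedAddCommGroup A] [NormedSpace ℝ A] (𝒢 : LieGroupoid G B)
    (anchor : B → A →L[ℝ] B) (bracket : (B → A) → (B → A) → B → A) : Prop :=
  ∃ Φ : B → A →L[ℝ] E, ContDiff ℝ ∞ Φ ∧
    (∀ x, Function.Injective (Φ x)) ∧
    (∀ x, LinearMap.range (Φ x).toLinearMap = 𝒢.algebroidFibre x) ∧
    (∀ x a, 𝒢.algebroidAnchor x (Φ x a) = anchor x a) ∧
    ∀ α β : B → A, ContDiff ℝ ∞ α → ContDiff ℝ ∞ β →
      𝒢.IsAlgebroidBracket (fun x => Φ x (α x)) (fun x => Φ x (β x))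
        (fun x => Φ x (bracket α β x))

end LieGroupoid

/-! ### The weighted blow-up of the pair groupoid -/

/-- The plane. -/
abbrev Plane : Type := EuclideanSpace ℝ (Fin 2)

/-- The space of arrows: the complement in `ℝ⁴ = ℝ² × ℝ²` of the graph of `x ↦ - x / |x|²` over the
punctured plane. -/
def arrows : Set (Plane × Plane) :=
  {p : Plane × Plane | p.1 ≠ 0 ∧ p.2 = -((‖p.1‖ ^ 2)⁻¹ • p.1)}ᶜ

/-- The blow-down map `(x, a) ↦ (x, x + |x|² a)`. -/
def blowDown (p : Plane × Plane) : Plane × Plane :=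
  (p.1, p.1 + ‖p.1‖ ^ 2 • p.2)

/-- The arrows outside `{0} × ℝ²` are identified by the blow-down map with the arrows of the pair
groupoid of the punctured plane. -/
theorem bijOn_blowDown :
    Set.BijOn blowDown (arrows \ {p | p.1 = 0}) {q | q.1 ≠ 0 ∧ q.2 ≠ 0} := by
  refine ⟨?_, ?_, ?_⟩
  · rintro ⟨x, a⟩ ⟨hp, hx⟩
    have hx : x ≠ 0 := hx
    have hn : ‖x‖ ^ 2 ≠ 0 := by simpa using hx
    refine ⟨hx, fun h => hp ⟨hx, ?_⟩⟩
    have h : x + ‖x‖ ^ 2 • a = 0 := h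
    have h' : ‖x‖ ^ 2 • a = -x := by rw [← add_eq_zero_iff_eq_neg, add_comm]; exact h
    change a = -((‖x‖ ^ 2)⁻¹ • x)
    rw [← smul_neg, ← h', smul_smul, inv_mul_cancel₀ hn, one_smul]
  · rintro ⟨x, a⟩ ⟨-, hx⟩ ⟨y, b⟩ - h
    have hx : x ≠ 0 := hx
    have hn : ‖x‖ ^ 2 ≠ 0 := by simpa using hx
    simp only [blowDown, Prod.mk.injEq] at h
    obtain ⟨rfl, h⟩ := h
    have h := smul_right_injective Plane hn (add_left_cancel h)
    rw [h]
  · rintro ⟨x, y⟩ ⟨hx, hy⟩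
    have hx : x ≠ 0 := hx
    have hy : y ≠ 0 := hy
    have hn : ‖x‖ ^ 2 ≠ 0 := by simpa using hx
    refine ⟨(x, (‖x‖ ^ 2)⁻¹ • (y - x)), ⟨?_, hx⟩, ?_⟩
    · rintro ⟨-, h⟩
      have h : (‖x‖ ^ 2)⁻¹ • (y - x) = -((‖x‖ ^ 2)⁻¹ • x) := h
      rw [← smul_neg] at h
      have h := smul_right_injective Plane (inv_ne_zero hn) h
      exact hy (by simpa using h)
    · simp [blowDown, smul_smul, mul_inv_cancel₀ hn]

/-- The structure maps of `𝒢` restrict, over the punctured plane, to the structure maps of the pair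
groupoid of the punctured plane, pulled back along the bijection given by the blow-down map:
`s (x, y) = y`, `t (x, y) = x`, `u x = (x, x)`, `(x, y)⁻¹ = (y, x)`, `(x, y) (y, z) = (x, z)`. -/
structure ExtendsPairGroupoid (𝒢 : LieGroupoid arrows Plane) : Prop where
  src_eq : ∀ g : arrows, g.1.1 ≠ 0 → 𝒢.src g = (blowDown g).2
  tgt_eq : ∀ g : arrows, g.1.1 ≠ 0 → 𝒢.tgt g = (blowDown g).1
  unit_eq : ∀ x : Plane, x ≠ 0 → blowDown (𝒢.unit x) = (x, x)
  inv_eq : ∀ g : arrows, g.1.1 ≠ 0 → blowDown (𝒢.inv g) = ((blowDown g).2, (blowDown g).1)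
  mul_eq : ∀ (g h : arrows) (e : 𝒢.src g = 𝒢.tgt h), g.1.1 ≠ 0 → h.1.1 ≠ 0 →
    blowDown (𝒢.mul g h e) = ((blowDown g).1, (blowDown h).2)

/-! ### The elliptic tangent bundle of the plane with divisor the origin -/

/-- The ring of smooth functions on the plane. -/
def smoothFunctions : Subalgebra ℝ (Plane → ℝ) where
  carrier := {f | ContDiff ℝ ∞ f}
  mul_mem' {f g} hf hg := by
    have hf : ContDiff ℝ ∞ f := hf
    have hg : ContDiff ℝ ∞ g := hg
    exact hf.mul hg
  add_mem' {f g} hf hg := by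
    have hf : ContDiff ℝ ∞ f := hf
    have hg : ContDiff ℝ ∞ g := hg
    exact hf.add hg
  algebraMap_mem' c := (contDiff_const : ContDiff ℝ ∞ fun _ : Plane => c)

theorem smoothFunctions_contDiff (f : smoothFunctions) : ContDiff ℝ ∞ (f : Plane → ℝ) := f.2

/-- The elliptic ideal, generated by `r²`. -/
def ellipticIdeal : Ideal smoothFunctions :=
  Ideal.span {⟨fun x => ‖x‖ ^ 2, (contDiff_norm_sq ℝ : ContDiff ℝ ∞ fun x : Plane => ‖x‖ ^ 2)⟩}

/-- The derivative `X f` of a smooth function along a smooth vector field. -/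
def derivAlong (X : Plane → Plane) (hX : ContDiff ℝ ∞ X) (f : smoothFunctions) :
    smoothFunctions :=
  ⟨fun x => fderiv ℝ (f : Plane → ℝ) x (X x),
    (((smoothFunctions_contDiff f).fderiv_right (m := ∞) (by simp)).clm_apply hX :
      ContDiff ℝ ∞ fun x => fderiv ℝ (f : Plane → ℝ) x (X x))⟩

/-- The sections of the elliptic tangent bundle: the smooth vector fields on the plane that
preserve the elliptic ideal. -/
def ellipticFields : Submodule smoothFunctions (Plane → Plane) where
  carrier := {X | ∃ hX : ContDiff ℝ ∞ X, ∀ f ∈ ellipticIdeal, derivAlong X hX f ∈ ellipticIdeal}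
  zero_mem' := ⟨contDiff_const, fun f _ => by
    convert ellipticIdeal.zero_mem
    ext x
    exact map_zero (fderiv ℝ (f : Plane → ℝ) x)⟩
  add_mem' := by
    rintro X Y ⟨hX, hX'⟩ ⟨hY, hY'⟩
    refine ⟨hX.add hY, fun f hf => ?_⟩
    convert ellipticIdeal.add_mem (hX' f hf) (hY' f hf)
    ext x
    exact map_add (fderiv ℝ (f : Plane → ℝ) x) (X x) (Y x)
  smul_mem' := by
    rintro c X ⟨hX, hX'⟩
    refine ⟨(smoothFunctions_contDiff c).smul hX, fun f hf => ?_⟩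
    convert ellipticIdeal.mul_mem_left c (hX' f hf)
    ext x
    exact map_smul (fderiv ℝ (f : Plane → ℝ) x) (c.1 x) (X x)

theorem lieBracket_mem (X Y : ellipticFields) :
    VectorField.lieBracket ℝ (X : Plane → Plane) Y ∈ ellipticFields := by
  obtain ⟨X, hX, hX'⟩ := X
  obtain ⟨Y, hY, hY'⟩ := Y
  refine ⟨hX.lieBracket_vectorField hY (by simp), fun f hf => ?_⟩
  convert ellipticIdeal.sub_mem (hX' _ (hY' f hf)) (hY' _ (hX' f hf))
  ext x
  exact VectorField.fderiv_apply_lieBracket (smoothFunctions_contDiff f).contDiffAt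
    (by simp only [minSmoothness_of_isRCLikeNormedField]; exact ENat.LEInfty.out)
    (hY.differentiable (by simp) x) (hX.differentiable (by simp) x)

/-- The Lie bracket of sections of the elliptic tangent bundle. -/
def ellipticBracket (X Y : ellipticFields) : ellipticFields :=
  ⟨VectorField.lieBracket ℝ (X : Plane → Plane) Y, lieBracket_mem X Y⟩

/-- The derivative of a smooth function along the anchor of a section of the elliptic tangent
bundle. -/
def ellipticDeriv (X : ellipticFields) (f : smoothFunctions) : smoothFunctions :=
  derivAlong X X.2.choose f

/-- An elliptic symplectic form: a two-form on the elliptic tangent bundle, given by its values on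
sections, that is nondegenerate and closed for the Lie algebroid differential. -/
structure IsEllipticSymplectic
    (Ω : ellipticFields →ₗ[smoothFunctions] Module.Dual smoothFunctions ellipticFields) :
    Prop where
  alternating : ∀ X, Ω X X = 0
  nondegenerate : Function.Bijective Ω
  closed : ∀ X Y Z,
    ellipticDeriv X (Ω Y Z) + ellipticDeriv Y (Ω Z X) + ellipticDeriv Z (Ω X Y)
      - Ω (ellipticBracket X Y) Z - Ω (ellipticBracket Y Z) X - Ω (ellipticBracket Z X) Y = 0

/-- `P` is the bundle map `π♯ : T*ℝ² → Tℝ²` of an elliptic Poisson structure `π` on the plane with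
divisor the origin: `π♯ = ρ ∘ (Ω♭)⁻¹ ∘ ρ*` for an elliptic symplectic form `Ω`, where `ρ` is the
anchor of the elliptic tangent bundle and `Ω♭ X = Ω (X, ·)`. -/
def IsEllipticPoisson (P : Plane → (Plane →L[ℝ] ℝ) →L[ℝ] Plane) : Prop :=
  ∃ Ω : ellipticFields →ₗ[smoothFunctions] Module.Dual smoothFunctions ellipticFields,
    IsEllipticSymplectic Ω ∧
    ∀ α : Plane → Plane →L[ℝ] ℝ, ContDiff ℝ ∞ α →
      ∃ X : ellipticFields, (∀ (Y : ellipticFields) (x : Plane),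
          (Ω X Y : Plane → ℝ) x = α x ((Y : Plane → Plane) x)) ∧
        ∀ x, P x (α x) = (X : Plane → Plane) x

/-! ### The two Lie algebroids -/

/-- The Lie derivative of a one-form along a vector field. -/
def lieDerivOneForm (X : Plane → Plane) (β : Plane → Plane →L[ℝ] ℝ) (x : Plane) :
    Plane →L[ℝ] ℝ :=
  fderiv ℝ β x (X x) + (β x).comp (fderiv ℝ X x)

/-- The bracket of the cotangent Lie algebroid of a Poisson structure with bundle map `P = π♯`:
`[α, β] = L_{π♯ α} β - L_{π♯ β} α - d (π (α, β))`, where `π (α, β) = β (π♯ α)`. -/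
def cotangentBracket (P : Plane → (Plane →L[ℝ] ℝ) →L[ℝ] Plane)
    (α β : Plane → Plane →L[ℝ] ℝ) (x : Plane) : Plane →L[ℝ] ℝ :=
  lieDerivOneForm (fun y => P y (α y)) β x - lieDerivOneForm (fun y => P y (β y)) α x
    - fderiv ℝ (fun y => β y (P y (α y))) x

/-- The anchor of the Lie algebroid `span (r² ∂₁, r² ∂₂)`, trivialised by its frame. -/
def spanAnchor (x : Plane) : Plane →L[ℝ] Plane :=
  ‖x‖ ^ 2 • ContinuousLinearMap.id ℝ Plane

/-- The bracket of the Lie algebroid `span (r² ∂₁, r² ∂₂)`, trivialised by its frame: the bracket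
of vector fields `[r² V, r² W]`, divided by `r²`. -/
def spanBracket (V W : Plane → Plane) (x : Plane) : Plane :=
  ‖x‖ ^ 2 • VectorField.lieBracket ℝ V W x
    + (2 * inner ℝ x (V x)) • W x - (2 * inner ℝ x (W x)) • V x

theorem spanAnchor_spanBracket (V W : Plane → Plane) (hV : ContDiff ℝ ∞ V) (hW : ContDiff ℝ ∞ W)
    (x : Plane) : spanAnchor x (spanBracket V W x) =
      VectorField.lieBracket ℝ (fun y => spanAnchor y (V y)) (fun y => spanAnchor y (W y)) x := by
  have hV := hV.differentiable (by simp) x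
  have hW := hW.differentiable (by simp) x
  have hn : HasFDerivAt (fun y : Plane => ‖y‖ ^ 2) (2 • innerSL ℝ x) x :=
    (hasStrictFDerivAt_norm_sq x).hasFDerivAt
  simp only [spanAnchor, spanBracket, VectorField.lieBracket, smul_apply,
    ContinuousLinearMap.id_apply]
  rw [(hn.fun_smul hV.hasFDerivAt).fderiv, (hn.fun_smul hW.hasFDerivAt).fderiv]
  simp only [add_apply, smul_apply,
    ContinuousLinearMap.smulRight_apply, innerSL_apply_apply, map_smul]
  module

end EllipticGroupoid

end

open scoped ContDiff

noncomputable section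

namespace EllipticGroupoid

/-! Everything rests on the function `dilation`, δ(x,a) = 1 + 2⟨x,a⟩ + |x|²|a|², with |x + |x|²a|² =
|x|²δ(x,a). It equals 1 at x = 0 and vanishes exactly on the deleted graph, so it is a smooth unit
on `arrows`. Solving z = y + |y|²b with y = x + |x|²a gives z = x + |x|²(a + δb). Hence the pair
groupoid product and inverse read (x, a + δb) and (y, -δ⁻¹a). These formulas are smooth across x =
0, and the groupoid laws follow from multiplicativity of δ (`dilation_product`, `dilation_inverse`).
Uniqueness is a density argument: the structure maps are continuous and prescribed off x = 0.

At a unit (x,0), ker ds consists of the vectors (r²V, -V). These extend explicitly to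
right-invariant fields, whose brackets give `spanBracket`.

For an elliptic symplectic form Ω, evaluate on the Euler field E and the rotation field R. The
function u = Ω(E,R) vanishes nowhere, the delicate point being the origin
(`IsEllipticSymplectic.form_euler_rotation_ne_zero`). Pairing with E and R then shows π = r²u⁻¹
∂₁∧∂₂. With c = u⁻¹, the bundle map c · `standardSharp` is an isomorphism from the cotangent
algebroid to span(r²∂₁, r²∂₂): it divides the anchor by r², and it respects brackets by
`smul_standardSharp_cotangentBracket`. -/

/-! ### Smooth maps on open subsets -/

section OpenSubset

variable {E F : Type*} [NormedAddCommGroup E] [NormedSpace ℝ E]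
  [NormedAddCommGroup F] [NormedSpace ℝ F] {S : Set E}

theorem extend_val_apply {E F : Type*} [Zero F] {S : Set E} (f : S → F) (g : S) :
    Function.extend Subtype.val f 0 (g : E) = f g :=
  Subtype.val_injective.extend_apply f 0 g

theorem smoothOnSubset_of_contDiffOn {f : S → F} {f' : E → F} (hf : ContDiffOn ℝ ∞ f' S)
    (h : ∀ g : S, f g = f' g) : SmoothOnSubset S f :=
  hf.congr fun x hx => (extend_val_apply f ⟨x, hx⟩).trans (h ⟨x, hx⟩)

theorem SmoothOnSubset.continuous {f : S → F} (hf : SmoothOnSubset S f) : Continuous f := by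
  have h := continuousOn_iff_continuous_domRestrict.1 (ContDiffOn.continuousOn hf)
  convert h using 1
  ext g
  exact (extend_val_apply f g).symm

theorem differential_eq_of_hasFDerivAt (hS : IsOpen S) {f : S → F} {f' : E → F}
    (h : ∀ g : S, f g = f' g) {g : S} {L : E →L[ℝ] F} (hL : HasFDerivAt f' L (g : E)) :
    differential f g = L := by
  refine (hL.congr_of_eventuallyEq ?_).fderiv
  filter_upwards [hS.mem_nhds g.2] with x hx
  exact (extend_val_apply f ⟨x, hx⟩).trans (h ⟨x, hx⟩)

end OpenSubset

/-- All other fields are propositions, so the five maps determine the groupoid. -/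
theorem LieGroupoid.ext_maps {E : Type*} [NormedAddCommGroup E] [NormedSpace ℝ E] {G : Set E}
    {B : Type*} [NormedAddCommGroup B] [NormedSpace ℝ B] {𝒢 𝒢' : LieGroupoid G B}
    (hs : 𝒢.src = 𝒢'.src) (ht : 𝒢.tgt = 𝒢'.tgt) (hu : 𝒢.unit = 𝒢'.unit) (hi : 𝒢.inv = 𝒢'.inv)
    (hm : ∀ g h e e', 𝒢.mul g h e = 𝒢'.mul g h e') : 𝒢 = 𝒢' := by
  cases 𝒢
  cases 𝒢'
  dsimp only at hs ht hu hi hm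
  subst hs ht hu hi
  obtain rfl := funext fun g => funext fun h => funext fun e => hm g h e e
  rfl

/-! ### The structure maps -/

/-- The ratio `|s|² / |t|²` of an arrow, which extends smoothly over `t = 0`. -/
def dilation (p : Plane × Plane) : ℝ :=
  1 + 2 * inner ℝ p.1 p.2 + ‖p.1‖ ^ 2 * ‖p.2‖ ^ 2

/-- The source of an arrow. -/
def source (p : Plane × Plane) : Plane :=
  p.1 + ‖p.1‖ ^ 2 • p.2

/-- The product of two composable arrows. -/
def product (p q : Plane × Plane) : Plane × Plane :=
  (p.1, p.2 + dilation p • q.2)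

/-- The inverse of an arrow. -/
def inverse (p : Plane × Plane) : Plane × Plane :=
  (source p, -((dilation p)⁻¹ • p.2))

theorem norm_source_sq (p : Plane × Plane) : ‖source p‖ ^ 2 = ‖p.1‖ ^ 2 * dilation p := by
  rw [source, norm_add_sq_real, inner_smul_right, norm_smul, norm_pow, norm_norm, dilation]
  ring

/-- Over x = 0 nothing is deleted and δ = 1; elsewhere |x|²δ = |s|² shows that δ vanishes exactly
when the source does. -/
theorem mem_arrows_iff {p : Plane × Plane} : p ∈ arrows ↔ dilation p ≠ 0 := by
  obtain ⟨x, a⟩ := p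
  refine not_congr ?_
  change (x ≠ 0 ∧ a = -((‖x‖ ^ 2)⁻¹ • x)) ↔ _
  by_cases hx : x = 0
  · simp [hx, dilation]
  have hn : ‖x‖ ^ 2 ≠ 0 := by simpa using hx
  have h := norm_source_sq (x, a)
  have h₁ : dilation (x, a) = 0 ↔ source (x, a) = 0 := by
    rw [← norm_eq_zero (a := source (x, a)), ← sq_eq_zero_iff (a := ‖_‖), h, mul_eq_zero, or_iff_right hn]
  rw [h₁, source, and_iff_right hx, add_eq_zero_iff_neg_eq, ← smul_neg,
    eq_inv_smul_iff₀ hn]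
  exact eq_comm

/-- Off the origin this is the cocycle rule for the ratio |s|²/|t|². The expansion of inner products
also covers the arrows over the origin. -/
theorem dilation_product {p q : Plane × Plane} (h : source p = q.1) :
    dilation (product p q) = dilation p * dilation q := by
  have hn : ‖q.1‖ ^ 2 = ‖p.1‖ ^ 2 * dilation p := by rw [← h, norm_source_sq]
  have hi : inner ℝ q.1 q.2 = inner ℝ p.1 q.2 + ‖p.1‖ ^ 2 * inner ℝ p.2 q.2 := by
    rw [← h, source, inner_add_left, real_inner_smul_left]
  rw [dilation.eq_def q, hn, hi, dilation.eq_def (product p q), product]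
  dsimp only
  rw [norm_add_sq_real, inner_add_right, inner_smul_right, inner_smul_right, norm_smul, mul_pow,
    Real.norm_eq_abs, sq_abs]
  linear_combination (dilation.eq_def p).symm

theorem dilation_inverse {p : Plane × Plane} (h : dilation p ≠ 0) :
    dilation (inverse p) = (dilation p)⁻¹ := by
  rw [dilation.eq_def (inverse p), inverse]
  dsimp only
  rw [norm_source_sq, norm_neg, norm_smul, inner_neg_right, inner_smul_right, source,
    inner_add_left, real_inner_smul_left, real_inner_self_eq_norm_sq, mul_pow,
    Real.norm_eq_abs, sq_abs]
  field_simp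
  rw [dilation]
  ring

theorem source_product {p q : Plane × Plane} (h : source p = q.1) :
    source (product p q) = source q := by
  rw [source.eq_def q, ← h, norm_source_sq, source, source, product]
  module

theorem source_inverse {p : Plane × Plane} (h : dilation p ≠ 0) : source (inverse p) = p.1 := by
  rw [source, inverse]
  dsimp only
  rw [norm_source_sq, smul_neg, smul_smul, mul_assoc, mul_inv_cancel₀ h, mul_one, source]
  abel

theorem contDiff_dilation : ContDiff ℝ ∞ dilation := by
  have h : ContDiff ℝ ∞ fun p : Plane × Plane => inner ℝ p.1 p.2 :=
    contDiff_fst.inner ℝ contDiff_snd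
  exact (contDiff_const.add (contDiff_const.mul h)).add
    ((contDiff_fst.norm_sq ℝ).mul (contDiff_snd.norm_sq ℝ))

theorem contDiff_source : ContDiff ℝ ∞ source :=
  contDiff_fst.add ((contDiff_fst.norm_sq ℝ).smul contDiff_snd)

theorem contDiffOn_inverse : ContDiffOn ℝ ∞ inverse arrows :=
  contDiff_source.contDiffOn.prodMk
    ((contDiff_dilation.contDiffOn.inv fun _ hp => mem_arrows_iff.1 hp).smul
      contDiff_snd.contDiffOn).neg

theorem contDiff_product : ContDiff ℝ ∞ fun p : (Plane × Plane) × (Plane × Plane) =>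
    product p.1 p.2 :=
  (contDiff_fst.comp contDiff_fst).prodMk ((contDiff_snd.comp contDiff_fst).add
    ((contDiff_dilation.comp contDiff_fst).smul (contDiff_snd.comp contDiff_snd)))

theorem isOpen_arrows : IsOpen arrows := by
  have h : arrows = dilation ⁻¹' {0}ᶜ := Set.ext fun p => mem_arrows_iff
  rw [h]
  exact isOpen_compl_singleton.preimage contDiff_dilation.continuous

theorem hasFDerivAt_source (p : Plane × Plane) : HasFDerivAt source
    (ContinuousLinearMap.fst ℝ Plane Plane + (‖p.1‖ ^ 2 • ContinuousLinearMap.snd ℝ Plane Plane +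
      ((2 • innerSL ℝ p.1).comp (ContinuousLinearMap.fst ℝ Plane Plane)).smulRight p.2)) p := by
  have hn : HasFDerivAt (fun y : Plane => ‖y‖ ^ 2) (2 • innerSL ℝ p.1) p.1 :=
    (hasStrictFDerivAt_norm_sq p.1).hasFDerivAt
  exact hasFDerivAt_fst.add ((hn.comp p hasFDerivAt_fst).fun_smul hasFDerivAt_snd)

/-- The weighted blow-up of the pair groupoid of the plane at the origin. -/
def blowUpGroupoid : LieGroupoid arrows Plane where
  isOpen_arrows := isOpen_arrows
  src g := source g
  tgt g := g.1.1
  unit x := ⟨(x, 0), mem_arrows_iff.2 (by simp [dilation])⟩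
  inv g := ⟨inverse g, mem_arrows_iff.2 (by
    rw [dilation_inverse (mem_arrows_iff.1 g.2)]
    exact inv_ne_zero (mem_arrows_iff.1 g.2))⟩
  mul g h e := ⟨product g h, mem_arrows_iff.2 (by
    rw [dilation_product e]
    exact mul_ne_zero (mem_arrows_iff.1 g.2) (mem_arrows_iff.1 h.2))⟩
  src_unit x := by simp [source]
  tgt_unit _ := rfl
  src_inv g := source_inverse (mem_arrows_iff.1 g.2)
  tgt_inv _ := rfl
  src_mul _ _ e := source_product e
  tgt_mul _ _ _ := rfl
  unit_mul g := Subtype.ext (by simp [product, dilation])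
  mul_unit g := Subtype.ext (by simp [product])
  mul_assoc g h k e e' := Subtype.ext (by
    refine Prod.ext rfl ?_
    change (g.1.2 + dilation g • h.1.2) + dilation (product g h) • k.1.2
      = g.1.2 + dilation g • (h.1.2 + dilation h • k.1.2)
    rw [dilation_product e]
    module)
  inv_mul g := Subtype.ext (by
    refine Prod.ext rfl ?_
    change -((dilation g)⁻¹ • g.1.2) + dilation (inverse g) • g.1.2 = 0
    rw [dilation_inverse (mem_arrows_iff.1 g.2), neg_add_cancel])
  mul_inv g := Subtype.ext (by
    refine Prod.ext rfl ?_
    change g.1.2 + dilation g • -((dilation g)⁻¹ • g.1.2) = 0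
    rw [smul_neg, smul_inv_smul₀ (mem_arrows_iff.1 g.2), add_neg_cancel])
  smooth_src := smoothOnSubset_of_contDiffOn contDiff_source.contDiffOn fun _ => rfl
  smooth_tgt := smoothOnSubset_of_contDiffOn contDiff_fst.contDiffOn fun _ => rfl
  smooth_unit := contDiff_id.prodMk contDiff_const
  smooth_inv := smoothOnSubset_of_contDiffOn contDiffOn_inverse fun _ => rfl
  smooth_mul := ⟨_, contDiff_product.contDiffOn, fun _ _ _ => rfl⟩
  submersion_src g := by
    rw [differential_eq_of_hasFDerivAt isOpen_arrows (fun _ => rfl) (hasFDerivAt_source g)]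
    intro v
    -- At the origin ds is the first projection; elsewhere the a-directions alone already fill the
    -- plane.
    by_cases hx : g.1.1 = 0
    · exact ⟨(v, 0), by simp [hx]⟩
    · have hn : ‖g.1.1‖ ^ 2 ≠ 0 := by simpa using hx
      exact ⟨(0, (‖g.1.1‖ ^ 2)⁻¹ • v), by simp [smul_smul, mul_inv_cancel₀ hn]⟩
  submersion_tgt g := by
    rw [differential_eq_of_hasFDerivAt isOpen_arrows (fun _ => rfl)
      (hasFDerivAt_fst (p := (g : Plane × Plane)))]
    exact fun v => ⟨(v, 0), rfl⟩

theorem extendsPairGroupoid_blowUpGroupoid : ExtendsPairGroupoid blowUpGroupoid where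
  src_eq _ _ := rfl
  tgt_eq _ _ := rfl
  unit_eq x _ := by simp [blowDown, blowUpGroupoid]
  inv_eq g _ := Prod.ext rfl (source_inverse (mem_arrows_iff.1 g.2))
  mul_eq _ _ e _ _ := Prod.ext rfl (source_product e)

/-! ### Uniqueness -/

theorem dense_fst_ne_zero (E F : Type*) [NormedAddCommGroup E] [NormedSpace ℝ E] [Nontrivial E]
    [TopologicalSpace F] : Dense {p : E × F | p.1 ≠ 0} := by
  have : (nhdsWithin (0 : E) {0}ᶜ).NeBot := Module.punctured_nhds_neBot ℝ E 0
  exact (dense_compl_singleton (0 : E)).preimage isOpenMap_fst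

theorem eq_of_eq_off_zero {X : Type*} [TopologicalSpace X] [T2Space X] {f f' : arrows → X}
    (hf : Continuous f) (hf' : Continuous f') (h : ∀ g : arrows, g.1.1 ≠ 0 → f g = f' g) :
    f = f' :=
  hf.ext_on ((dense_fst_ne_zero Plane Plane).preimage isOpen_arrows.isOpenMap_subtype_val) hf' h

theorem blowDown_injOn {p q : Plane × Plane} (hp : p.1 ≠ 0) (h : blowDown p = blowDown q) :
    p = q := by
  obtain ⟨x, a⟩ := p
  obtain ⟨y, b⟩ := q
  have hn : ‖x‖ ^ 2 ≠ 0 := by simpa using hp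
  simp only [blowDown, Prod.mk.injEq] at h
  obtain ⟨rfl, h⟩ := h
  rw [smul_right_injective Plane hn (add_left_cancel h)]

theorem ExtendsPairGroupoid.eq_blowUpGroupoid {𝒢 : LieGroupoid arrows Plane}
    (h𝒢 : ExtendsPairGroupoid 𝒢) : 𝒢 = blowUpGroupoid := by
  have h₀ := extendsPairGroupoid_blowUpGroupoid
  have hs : 𝒢.src = blowUpGroupoid.src :=
    eq_of_eq_off_zero 𝒢.smooth_src.continuous blowUpGroupoid.smooth_src.continuous
      fun g hg => (h𝒢.src_eq g hg).trans (h₀.src_eq g hg).symm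
  have ht : 𝒢.tgt = blowUpGroupoid.tgt :=
    eq_of_eq_off_zero 𝒢.smooth_tgt.continuous blowUpGroupoid.smooth_tgt.continuous
      fun g hg => (h𝒢.tgt_eq g hg).trans (h₀.tgt_eq g hg).symm
  -- Arrows starting off the origin also end off it, so inverses and second factors stay in the
  -- region where the pair groupoid prescribes the maps.
  have hsource : ∀ g : arrows, g.1.1 ≠ 0 → source g ≠ 0 := fun g hg h => by
    have h' := norm_source_sq g
    rw [h, norm_zero, zero_pow two_ne_zero, eq_comm, mul_eq_zero] at h'
    exact h'.elim (by simpa using hg) (mem_arrows_iff.1 g.2)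
  refine LieGroupoid.ext_maps hs ht ?_ ?_ fun g h e e' => ?_
  · have h : (fun x => (𝒢.unit x : Plane × Plane)) = fun x => (blowUpGroupoid.unit x).1 := by
      have : (nhdsWithin (0 : Plane) {0}ᶜ).NeBot := Module.punctured_nhds_neBot ℝ Plane 0
      refine 𝒢.smooth_unit.continuous.ext_on (dense_compl_singleton (0 : Plane))
        blowUpGroupoid.smooth_unit.continuous fun x hx => ?_
      have e := (h₀.unit_eq x hx).trans (h𝒢.unit_eq x hx).symm
      exact (blowDown_injOn (show (blowUpGroupoid.unit x).1.1 ≠ 0 from hx) e).symm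
    exact funext fun x => Subtype.ext (congrFun h x)
  · have h : (fun g => (𝒢.inv g : Plane × Plane)) = fun g => (blowUpGroupoid.inv g).1 := by
      refine eq_of_eq_off_zero 𝒢.smooth_inv.continuous blowUpGroupoid.smooth_inv.continuous
        fun g hg => ?_
      have e := (h₀.inv_eq g hg).trans (h𝒢.inv_eq g hg).symm
      exact (blowDown_injOn (show (blowUpGroupoid.inv g).1.1 ≠ 0 from hsource g hg) e).symm
    exact funext fun x => Subtype.ext (congrFun h x)
  · obtain ⟨μ, hμ, hmul⟩ := 𝒢.smooth_mul
    -- The second factor of a composable pair is fixed by the first and by its fibre coordinate.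
    -- This identifies composable pairs with an open set, in which the pairs off the origin are
    -- dense.
    let T : Set ((Plane × Plane) × Plane) :=
      {q | q.1 ∈ arrows ∧ (source q.1, q.2) ∈ arrows}
    have hc : Continuous fun q : (Plane × Plane) × Plane => (source q.1, q.2) :=
      (contDiff_source.continuous.comp continuous_fst).prodMk continuous_snd
    have hT : IsOpen T :=
      (isOpen_arrows.preimage continuous_fst).inter (isOpen_arrows.preimage hc)
    have hd : Dense {q : (Plane × Plane) × Plane | q.1.1 ≠ 0} :=
      (dense_fst_ne_zero Plane Plane).preimage isOpenMap_fst
    have hcomp : ∀ q : T, 𝒢.src ⟨q.1.1, q.2.1⟩ = 𝒢.tgt ⟨_, q.2.2⟩ := fun q => by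
      rw [hs, ht]
      rfl
    have h₁ : Continuous fun q : T => μ (q.1.1, (source q.1.1, q.1.2)) :=
      hμ.continuousOn.comp_continuous
        ((continuous_fst.prodMk hc).comp continuous_subtype_val)
        fun q => ⟨_, _, hcomp q, rfl⟩
    have h₂ : Continuous fun q : T => product q.1.1 (source q.1.1, q.1.2) :=
      contDiff_product.continuous.comp
        ((continuous_fst.prodMk hc).comp continuous_subtype_val)
    have h₃ := h₁.ext_on (hd.preimage hT.isOpenMap_subtype_val) h₂ fun q hq => by
      refine (hmul ⟨q.1.1, q.2.1⟩ ⟨_, q.2.2⟩ (hcomp q)).trans ?_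
      have hx : q.1.1.1 ≠ 0 := hq
      have e₁ := h𝒢.mul_eq ⟨q.1.1, q.2.1⟩ ⟨_, q.2.2⟩ (hcomp q) hx (hsource ⟨q.1.1, q.2.1⟩ hx)
      have e₂ := h₀.mul_eq ⟨q.1.1, q.2.1⟩ ⟨_, q.2.2⟩ rfl hx (hsource ⟨q.1.1, q.2.1⟩ hx)
      exact (blowDown_injOn (by exact hx) (e₂.trans e₁.symm)).symm
    have hh : h.1 = (source g, h.1.2) := Prod.ext (e'.symm : h.1.1 = source g) rfl
    have h₄ := congrFun h₃ ⟨(g.1, h.1.2), g.2, by rw [← hh]; exact h.2⟩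
    dsimp only at h₄
    rw [← hh] at h₄
    exact Subtype.ext ((hmul g h e).symm.trans h₄)

/-! ### The Lie algebroid -/

theorem differential_src (g : arrows) : differential blowUpGroupoid.src g =
    ContinuousLinearMap.fst ℝ Plane Plane + (‖g.1.1‖ ^ 2 • ContinuousLinearMap.snd ℝ Plane Plane +
      ((2 • innerSL ℝ g.1.1).comp (ContinuousLinearMap.fst ℝ Plane Plane)).smulRight g.1.2) :=
  differential_eq_of_hasFDerivAt isOpen_arrows (fun _ => rfl) (hasFDerivAt_source g)

theorem differential_tgt (g : arrows) :
    differential blowUpGroupoid.tgt g = ContinuousLinearMap.fst ℝ Plane Plane :=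
  differential_eq_of_hasFDerivAt isOpen_arrows (fun _ => rfl) hasFDerivAt_fst

/-- The right-invariant vector field that extends the section of the Lie algebroid corresponding
to `|x|² V`. -/
def rightInvariantField (V : Plane → Plane) (p : Plane × Plane) : Plane × Plane :=
  (‖p.1‖ ^ 2 • V p.1, -V p.1 - (2 * inner ℝ p.1 (V p.1)) • p.2)

theorem contDiff_rightInvariantField {V : Plane → Plane} (hV : ContDiff ℝ ∞ V) :
    ContDiff ℝ ∞ (rightInvariantField V) := by
  have hV' : ContDiff ℝ ∞ fun p : Plane × Plane => V p.1 := hV.comp contDiff_fst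
  exact ((contDiff_fst.norm_sq ℝ).smul hV').prodMk
    (hV'.neg.sub ((contDiff_const.mul (contDiff_fst.inner ℝ hV')).smul contDiff_snd))

/-- The field comes from moving x with velocity |x|²V while keeping y fixed in a = (y - x)/|x|². -/
theorem isRightInvariant_rightInvariantField {V : Plane → Plane} (hV : ContDiff ℝ ∞ V) :
    blowUpGroupoid.IsRightInvariant (rightInvariantField V) := by
  refine ⟨(contDiff_rightInvariantField hV).contDiffOn, fun g => ?_, fun g h e γ hγ h0 hd => ?_⟩
  · rw [differential_src]
    simp [rightInvariantField]
    module
  · have h₁ : HasDerivAt (fun τ => (γ τ).1.1) (rightInvariantField V g).1 0 := hd.fst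
    have h₂ : HasDerivAt (fun τ => (γ τ).1.2) (rightInvariantField V g).2 0 := hd.snd
    -- Along a source fibre |x|²δ is constant, and |x|² has logarithmic derivative 2⟨x,V⟩; hence the
    -- factor -2⟨x,V⟩.
    have hD : HasDerivAt (fun τ => dilation (γ τ))
        (-(2 * inner ℝ g.1.1 (V g.1.1)) * dilation g) 0 := by
      have h₃ := (((h₁.inner ℝ h₂).const_mul 2).const_add 1).add (h₁.norm_sq.mul h₂.norm_sq)
      refine h₃.congr_deriv ?_
      simp only [h0, rightInvariantField, dilation, inner_sub_right, inner_neg_right,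
        inner_smul_right, real_inner_smul_left, real_inner_self_eq_norm_sq]
      rw [real_inner_comm g.1.2 (V g.1.1)]
      ring
    have h₄ := h₁.prodMk (h₂.add (hD.smul_const h.1.2))
    refine h₄.congr_deriv (Prod.ext rfl ?_)
    simp only [rightInvariantField, blowUpGroupoid, product]
    module

theorem fderiv_rightInvariantField {V : Plane → Plane} (hV : ContDiff ℝ ∞ V) (x v a : Plane) :
    fderiv ℝ (rightInvariantField V) (x, 0) (v, a) =
      (fderiv ℝ (fun y => ‖y‖ ^ 2 • V y) x v, -fderiv ℝ V x v - (2 * inner ℝ x (V x)) • a) := by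
  have hV₀ := hV.differentiable (by simp) x
  have hV₁ : HasFDerivAt (fun p : Plane × Plane => V p.1)
      ((fderiv ℝ V x).comp (ContinuousLinearMap.fst ℝ Plane Plane)) (x, (0 : Plane)) :=
    HasFDerivAt.comp (x, (0 : Plane)) (g := V) hV₀.hasFDerivAt hasFDerivAt_fst
  have hW : HasFDerivAt (fun p : Plane × Plane => ‖p.1‖ ^ 2 • V p.1)
      ((fderiv ℝ (fun y => ‖y‖ ^ 2 • V y) x).comp (ContinuousLinearMap.fst ℝ Plane Plane))
      (x, (0 : Plane)) :=
    HasFDerivAt.comp (x, (0 : Plane)) (g := fun y : Plane => ‖y‖ ^ 2 • V y)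
      (((contDiff_id.norm_sq ℝ).smul hV).differentiable (by simp) x).hasFDerivAt hasFDerivAt_fst
  have hI : HasFDerivAt (fun p : Plane × Plane => 2 * inner ℝ p.1 (V p.1)) _ (x, (0 : Plane)) :=
    (hasFDerivAt_fst.inner ℝ hV₁).const_mul 2
  have h := hW.prodMk (hV₁.neg.sub (hI.smul hasFDerivAt_snd))
  have h' : HasFDerivAt (rightInvariantField V) _ (x, (0 : Plane)) := h
  rw [h'.fderiv]
  simp

/-- The first component is the bracket of r²V and r²W on the base, as the fields project along the
target map. The second confirms that the result lies in ker ds. -/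
theorem lieBracket_rightInvariantField {V W : Plane → Plane} (hV : ContDiff ℝ ∞ V)
    (hW : ContDiff ℝ ∞ W) (x : Plane) :
    VectorField.lieBracket ℝ (rightInvariantField V) (rightInvariantField W) (x, 0) =
      (‖x‖ ^ 2 • spanBracket V W x, -spanBracket V W x) := by
  have h := spanAnchor_spanBracket V W hV hW x
  have e : ∀ V : Plane → Plane, rightInvariantField V (x, 0) = (‖x‖ ^ 2 • V x, -V x) := by
    simp [rightInvariantField]
  rw [VectorField.lieBracket, e, e, fderiv_rightInvariantField hV, fderiv_rightInvariantField hW]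
  refine Prod.ext h.symm ?_
  simp only [Prod.snd_sub, map_smul, spanBracket, VectorField.lieBracket]
  module

/-- The isomorphism from the trivial bundle onto the Lie algebroid. -/
def algebroidFrame (x : Plane) : Plane →L[ℝ] Plane × Plane :=
  (‖x‖ ^ 2 • ContinuousLinearMap.id ℝ Plane).prod (-ContinuousLinearMap.id ℝ Plane)

theorem algebroidFrame_apply (x v : Plane) : algebroidFrame x v = (‖x‖ ^ 2 • v, -v) := rfl

theorem contDiff_algebroidFrame : ContDiff ℝ ∞ algebroidFrame := by
  have h : algebroidFrame = fun x => ‖x‖ ^ 2 • ContinuousLinearMap.inl ℝ Plane Plane -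
      ContinuousLinearMap.inr ℝ Plane Plane := by
    ext x : 1
    ext v : 1
    simp [algebroidFrame_apply]
  rw [h]
  exact ((contDiff_id.norm_sq ℝ).smul contDiff_const).sub contDiff_const

theorem algebroidFrame_injective (x : Plane) : Function.Injective (algebroidFrame x) :=
  fun _ _ h => neg_injective (congrArg Prod.snd h)

theorem range_algebroidFrame (x : Plane) :
    LinearMap.range (algebroidFrame x).toLinearMap = blowUpGroupoid.algebroidFibre x := by
  ext ⟨v, a⟩
  rw [LieGroupoid.algebroidFibre, differential_src]
  simp only [LinearMap.mem_range, LinearMap.mem_ker, blowUpGroupoid,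
    ContinuousLinearMap.coe_coe, algebroidFrame_apply, Prod.mk.injEq]
  constructor
  · rintro ⟨w, rfl, rfl⟩
    simp
  · intro h
    refine ⟨-a, ?_, neg_neg a⟩
    rw [smul_neg, eq_comm]
    exact eq_neg_of_add_eq_zero_left (by simpa using h)

theorem algebroidAnchor_algebroidFrame (x v : Plane) :
    blowUpGroupoid.algebroidAnchor x (algebroidFrame x v) = spanAnchor x v := by
  rw [LieGroupoid.algebroidAnchor, differential_tgt]
  rfl

theorem isAlgebroidBracket_algebroidFrame {V W : Plane → Plane} (hV : ContDiff ℝ ∞ V)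
    (hW : ContDiff ℝ ∞ W) :
    blowUpGroupoid.IsAlgebroidBracket (fun x => algebroidFrame x (V x))
      (fun x => algebroidFrame x (W x)) (fun x => algebroidFrame x (spanBracket V W x)) := by
  refine ⟨rightInvariantField V, rightInvariantField W, isRightInvariant_rightInvariantField hV,
    isRightInvariant_rightInvariantField hW, fun x => ?_, fun x => ?_, fun x =>
    (lieBracket_rightInvariantField hV hW x).symm⟩ <;>
  simp [rightInvariantField, blowUpGroupoid, algebroidFrame_apply]

theorem integrates_span : blowUpGroupoid.Integrates spanAnchor spanBracket :=
  ⟨algebroidFrame, contDiff_algebroidFrame, algebroidFrame_injective, range_algebroidFrame,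
    algebroidAnchor_algebroidFrame, fun _ _ hV hW => isAlgebroidBracket_algebroidFrame hV hW⟩

/-- A Lie algebroid isomorphic to `span (r² ∂₁, r² ∂₂)` is integrated by the same groupoid. -/
theorem integrates_of_isomorphism {A : Type*} [NormedAddCommGroup A] [NormedSpace ℝ A]
    {anchor : Plane → A →L[ℝ] Plane} {bracket : (Plane → A) → (Plane → A) → Plane → A}
    {Ψ : Plane → A →L[ℝ] Plane} (hΨ : ContDiff ℝ ∞ Ψ) (hb : ∀ x, Function.Bijective (Ψ x))
    (ha : ∀ x a, spanAnchor x (Ψ x a) = anchor x a)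
    (hbr : ∀ α β : Plane → A, ContDiff ℝ ∞ α → ContDiff ℝ ∞ β → ∀ x,
      Ψ x (bracket α β x) = spanBracket (fun y => Ψ y (α y)) (fun y => Ψ y (β y)) x) :
    blowUpGroupoid.Integrates anchor bracket := by
  refine ⟨fun x => (algebroidFrame x).comp (Ψ x), contDiff_algebroidFrame.clm_comp hΨ,
    fun x => (algebroidFrame_injective x).comp (hb x).1, fun x => ?_, fun x a => ?_,
    fun α β hα hβ => ?_⟩
  · rw [← range_algebroidFrame, ContinuousLinearMap.toLinearMap_comp]
    exact LinearMap.range_comp_of_range_eq_top _ (LinearMap.range_eq_top.2 (hb x).2)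
  · exact (algebroidAnchor_algebroidFrame x _).trans (ha x a)
  · have h := isAlgebroidBracket_algebroidFrame (hΨ.clm_apply hα) (hΨ.clm_apply hβ)
    simp only [← hbr α β hα hβ] at h
    exact h

/-! ### Elliptic Poisson structures -/

theorem Plane.inner_eq (x y : Plane) : inner ℝ x y = x 0 * y 0 + x 1 * y 1 := by
  simp [PiLp.inner_apply, Fin.sum_univ_two, mul_comm]

theorem Plane.norm_sq_eq (x : Plane) : ‖x‖ ^ 2 = x 0 ^ 2 + x 1 ^ 2 := by
  simp [EuclideanSpace.norm_sq_eq, Fin.sum_univ_two]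

/-- The standard frame of the plane. -/
def frame (i : Fin 2) : Plane := EuclideanSpace.single i 1

theorem Plane.map_eq {F : Type*} [NormedAddCommGroup F] [NormedSpace ℝ F] (L : Plane →L[ℝ] F)
    (v : Plane) : L v = v 0 • L (frame 0) + v 1 • L (frame 1) := by
  have h : v = v 0 • frame 0 + v 1 • frame 1 := by
    ext i
    fin_cases i <;> simp [frame]
  conv_lhs => rw [h]
  simp

/-- The contraction with `∂₁ ∧ ∂₂`, as a bundle map from the cotangent to the tangent bundle. -/
def standardSharp : (Plane →L[ℝ] ℝ) →L[ℝ] Plane :=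
  (ContinuousLinearMap.apply ℝ ℝ (frame 1)).smulRight (frame 0) -
    (ContinuousLinearMap.apply ℝ ℝ (frame 0)).smulRight (frame 1)

theorem standardSharp_apply (α : Plane →L[ℝ] ℝ) :
    standardSharp α = α (frame 1) • frame 0 - α (frame 0) • frame 1 := rfl

theorem standardSharp_apply_zero (α : Plane →L[ℝ] ℝ) : standardSharp α 0 = α (frame 1) := by
  simp [standardSharp_apply, frame]

theorem standardSharp_apply_one (α : Plane →L[ℝ] ℝ) : standardSharp α 1 = -α (frame 0) := by
  simp [standardSharp_apply, frame]

theorem bijective_standardSharp : Function.Bijective standardSharp := by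
  constructor
  · intro α β h
    have h₀ : α (frame 0) = β (frame 0) := by
      rw [← neg_inj, ← standardSharp_apply_one, ← standardSharp_apply_one, h]
    have h₁ : α (frame 1) = β (frame 1) := by
      rw [← standardSharp_apply_zero, ← standardSharp_apply_zero, h]
    ext v
    rw [Plane.map_eq α, Plane.map_eq β, h₀, h₁]
  · intro v
    refine ⟨v 0 • EuclideanSpace.proj 1 - v 1 • EuclideanSpace.proj 0, ?_⟩
    ext i
    fin_cases i
    · exact (standardSharp_apply_zero _).trans (by simp [frame])
    · exact (standardSharp_apply_one _).trans (by simp [frame])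

/-! ### The cotangent bracket of r²c ∂₁∧∂₂ -/

section Bracket

variable {c : Plane → ℝ} {α β : Plane → Plane →L[ℝ] ℝ}

theorem fderiv_smul_standardSharp (hc : ContDiff ℝ ∞ c) (hα : ContDiff ℝ ∞ α) (x v : Plane) :
    fderiv ℝ (fun y => c y • standardSharp (α y)) x v =
      c x • standardSharp (fderiv ℝ α x v) + fderiv ℝ c x v • standardSharp (α x) := by
  have h := (hc.differentiable (by simp) x).hasFDerivAt.fun_smul
    (standardSharp.hasFDerivAt.comp x (hα.differentiable (by simp) x).hasFDerivAt)
  refine (DFunLike.congr_fun h.fderiv v).trans ?_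
  simp

theorem fderiv_pairing {V : Plane → Plane} (hV : ContDiff ℝ ∞ V) (hβ : ContDiff ℝ ∞ β)
    (x v : Plane) : fderiv ℝ (fun y => β y (V y)) x v =
      fderiv ℝ β x v (V x) + β x (fderiv ℝ V x v) := by
  have h := (hβ.differentiable (by simp) x).hasFDerivAt.clm_apply
    (hV.differentiable (by simp) x).hasFDerivAt
  rw [h.fderiv]
  simp [add_comm]

theorem fderiv_norm_sq_mul (hc : ContDiff ℝ ∞ c) (x v : Plane) :
    fderiv ℝ (fun y => ‖y‖ ^ 2 * c y) x v =
      2 * inner ℝ x v * c x + ‖x‖ ^ 2 * fderiv ℝ c x v := by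
  have hn : HasFDerivAt (fun y : Plane => ‖y‖ ^ 2) (2 • innerSL ℝ x) x :=
    (hasStrictFDerivAt_norm_sq x).hasFDerivAt
  rw [(hn.fun_mul (hc.differentiable (by simp) x).hasFDerivAt).fderiv]
  simp
  ring

/-- Conceptually, π♯ preserves brackets and this is that identity divided by r². The division is
avoided by comparing coordinates, which also covers the origin. -/
theorem smul_standardSharp_cotangentBracket {P : Plane → (Plane →L[ℝ] ℝ) →L[ℝ] Plane}
    (hc : ContDiff ℝ ∞ c) (hα : ContDiff ℝ ∞ α) (hβ : ContDiff ℝ ∞ β)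
    (hP : ∀ x ξ, P x ξ = (‖x‖ ^ 2 * c x) • standardSharp ξ) (x : Plane) :
    c x • standardSharp (cotangentBracket P α β x) =
      spanBracket (fun y => c y • standardSharp (α y)) (fun y => c y • standardSharp (β y)) x := by
  have hc' : ContDiff ℝ ∞ fun y : Plane => ‖y‖ ^ 2 * c y := (contDiff_id.norm_sq ℝ).mul hc
  have hsm : ContDiff ℝ ∞ fun y : Plane => (‖y‖ ^ 2 * c y) • standardSharp (α y) :=
    hc'.smul (standardSharp.contDiff.comp hα)
  -- By the product rule, d(β(π♯α)) cancels the term of the Lie derivative of β that differentiates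
  -- π♯α.
  have h : ∀ w, cotangentBracket P α β x w =
      fderiv ℝ β x (P x (α x)) w - fderiv ℝ α x (P x (β x)) w
      - α x (fderiv ℝ (fun y => P y (β y)) x w) - fderiv ℝ β x w (P x (α x)) := fun w => by
    simp only [hP]
    rw [cotangentBracket, lieDerivOneForm, lieDerivOneForm]
    simp only [hP, sub_apply, add_apply, ContinuousLinearMap.comp_apply, fderiv_pairing hsm hβ]
    ring
  simp only [hP, fderiv_smul_standardSharp hc' hβ, fderiv_norm_sq_mul hc] at h
  rw [spanBracket, VectorField.lieBracket, fderiv_smul_standardSharp hc hα,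
    fderiv_smul_standardSharp hc hβ]
  ext i
  fin_cases i
  all_goals
    simp only [Fin.zero_eta, Fin.mk_one, PiLp.smul_apply, PiLp.add_apply, PiLp.sub_apply,
      smul_eq_mul, standardSharp_apply_zero, standardSharp_apply_one, h, map_smul, map_add,
      smul_apply, Plane.inner_eq, Plane.norm_sq_eq]
    simp only [Plane.map_eq _ (standardSharp _), standardSharp_apply_zero,
      standardSharp_apply_one, smul_eq_mul, add_apply, smul_apply]
    simp [frame]
    ring

end Bracket

/-- The Poisson structures `r² c ∂₁ ∧ ∂₂` with `c` nowhere zero are integrated by the blow-up. -/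
theorem integrates_cotangent {P : Plane → (Plane →L[ℝ] ℝ) →L[ℝ] Plane} {c : Plane → ℝ}
    (hc : ContDiff ℝ ∞ c) (h0 : ∀ x, c x ≠ 0)
    (hP : ∀ x ξ, P x ξ = (‖x‖ ^ 2 * c x) • standardSharp ξ) :
    blowUpGroupoid.Integrates P (cotangentBracket P) :=
  integrates_of_isomorphism (Ψ := fun x => c x • standardSharp) (hc.smul contDiff_const)
    (fun x => (MulAction.bijective (Units.mk0 _ (h0 x))).comp bijective_standardSharp)
    (fun x ξ => by simp [hP, spanAnchor, smul_smul, mul_comm])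
    (fun _ _ hα hβ x => smul_standardSharp_cotangentBracket hc hα hβ hP x)

/-! ### Elliptic symplectic forms -/

theorem eq_of_eq_off_origin {X : Type*} [TopologicalSpace X] [T2Space X] {f f' : Plane → X}
    (hf : Continuous f) (hf' : Continuous f') (h : ∀ x, x ≠ 0 → f x = f' x) : f = f' := by
  have : (nhdsWithin (0 : Plane) {0}ᶜ).NeBot := Module.punctured_nhds_neBot ℝ Plane 0
  exact hf.ext_on (dense_compl_singleton (0 : Plane)) hf' h

theorem norm_sq_ne_zero {x : Plane} (hx : x ≠ 0) : ‖x‖ ^ 2 ≠ 0 := by simpa using hx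

theorem fderiv_norm_sq_apply (x v : Plane) :
    fderiv ℝ (fun y : Plane => ‖y‖ ^ 2) x v = 2 * inner ℝ x v := by
  rw [(hasStrictFDerivAt_norm_sq x).hasFDerivAt.fderiv]
  simp

theorem mem_ellipticIdeal {f : smoothFunctions} : f ∈ ellipticIdeal ↔
    ∃ g : smoothFunctions, ∀ x, (f : Plane → ℝ) x = ‖x‖ ^ 2 * (g : Plane → ℝ) x := by
  rw [ellipticIdeal, Ideal.mem_span_singleton']
  refine exists_congr fun g => ⟨?_, fun h => ?_⟩
  · rintro rfl x
    exact mul_comm _ _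
  · ext x
    exact (mul_comm _ _).trans (h x).symm

/-- A smooth vector field is elliptic if and only if its radial component is divisible by `r²`. -/
theorem mem_ellipticFields {X : Plane → Plane} (hX : ContDiff ℝ ∞ X) : X ∈ ellipticFields ↔
    ∃ h : smoothFunctions, ∀ x, inner ℝ x (X x) = ‖x‖ ^ 2 * (h : Plane → ℝ) x := by
  constructor
  · rintro ⟨_, h⟩
    obtain ⟨g, hg⟩ := mem_ellipticIdeal.1 (h _ (Ideal.subset_span rfl))
    refine ⟨(1 / 2 : ℝ) • g, fun x => ?_⟩
    have e : 2 * inner ℝ x (X x) = ‖x‖ ^ 2 * (g : Plane → ℝ) x :=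
      (fderiv_norm_sq_apply x (X x)).symm.trans (hg x)
    change _ = ‖x‖ ^ 2 * ((1 / 2 : ℝ) * (g : Plane → ℝ) x)
    linear_combination e / 2
  · rintro ⟨h, hh⟩
    refine ⟨hX, fun f hf => ?_⟩
    obtain ⟨g, hg⟩ := mem_ellipticIdeal.1 hf
    -- The quotient by r² comes from X(r²g) = 2⟨x,X⟩g + r²X(g).
    refine mem_ellipticIdeal.2 ⟨2 • (h * g) + derivAlong X hX g, fun x => ?_⟩
    have e : (f : Plane → ℝ) = fun y => ‖y‖ ^ 2 * (g : Plane → ℝ) y := funext hg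
    change fderiv ℝ (f : Plane → ℝ) x (X x) =
      ‖x‖ ^ 2 * ((2 • ((h : Plane → ℝ) x * (g : Plane → ℝ) x)) +
        fderiv ℝ (g : Plane → ℝ) x (X x))
    rw [e, fderiv_norm_sq_mul (smoothFunctions_contDiff g), hh]
    simp
    ring

theorem contDiff_ellipticField (X : ellipticFields) : ContDiff ℝ ∞ (X : Plane → Plane) :=
  X.2.choose

/-- The Euler vector field. -/
def eulerField : ellipticFields :=
  ⟨fun x => x, (mem_ellipticFields contDiff_id).2 ⟨1, fun x => by
    simp⟩⟩

/-- The rotation by a quarter turn. -/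
def quarterTurn : Plane →L[ℝ] Plane :=
  (EuclideanSpace.proj 0 : Plane →L[ℝ] ℝ).smulRight (frame 1) -
    (EuclideanSpace.proj 1 : Plane →L[ℝ] ℝ).smulRight (frame 0)

theorem quarterTurn_apply_zero (x : Plane) : quarterTurn x 0 = -x 1 := by
  simp [quarterTurn, frame]

theorem quarterTurn_apply_one (x : Plane) : quarterTurn x 1 = x 0 := by
  simp [quarterTurn, frame]

theorem inner_quarterTurn_self (x : Plane) : inner ℝ x (quarterTurn x) = 0 := by
  rw [Plane.inner_eq, quarterTurn_apply_zero, quarterTurn_apply_one]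
  ring

/-- The rotational vector field. -/
def rotationField : ellipticFields :=
  ⟨quarterTurn, (mem_ellipticFields quarterTurn.contDiff).2 ⟨0, fun x => by
    simp [inner_quarterTurn_self]⟩⟩

/-- The radial component of an elliptic vector field, divided by `r²`, as a functional. -/
theorem exists_radial_functional : ∃ l : Module.Dual smoothFunctions ellipticFields,
    ∀ (X : ellipticFields) (x : Plane),
      inner ℝ x ((X : Plane → Plane) x) = ‖x‖ ^ 2 * (l X : Plane → ℝ) x := by
  choose h hh using fun X : ellipticFields =>
    (mem_ellipticFields (contDiff_ellipticField X)).1 X.2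
  -- A quotient by r² is determined off the origin, hence everywhere by continuity; this makes the
  -- chosen quotients linear in X.
  have uniq : ∀ f g : smoothFunctions, (∀ x : Plane, ‖x‖ ^ 2 * (f : Plane → ℝ) x =
      ‖x‖ ^ 2 * (g : Plane → ℝ) x) → f = g := fun f g e =>
    Subtype.ext (eq_of_eq_off_origin (smoothFunctions_contDiff f).continuous
      (smoothFunctions_contDiff g).continuous
      fun x hx => mul_left_cancel₀ (norm_sq_ne_zero hx) (e x))
  refine ⟨⟨⟨h, fun X Y => uniq _ _ fun x => ?_⟩, fun f X => uniq _ _ fun x => ?_⟩, hh⟩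
  · rw [← hh]
    change inner ℝ x ((X : Plane → Plane) x + (Y : Plane → Plane) x) =
      ‖x‖ ^ 2 * ((h X : Plane → ℝ) x + (h Y : Plane → ℝ) x)
    rw [inner_add_right, hh, hh, mul_add]
  · rw [← hh]
    change inner ℝ x ((f : Plane → ℝ) x • (X : Plane → Plane) x) =
      ‖x‖ ^ 2 * ((f : Plane → ℝ) x * (h X : Plane → ℝ) x)
    rw [inner_smul_right, hh]
    ring

variable {Ω : ellipticFields →ₗ[smoothFunctions] Module.Dual smoothFunctions ellipticFields}

set_option synthInstance.maxHeartbeats 200000 in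
/-- Off the origin every vector field is a combination of the Euler and the rotational field;
this is the pairing of such a combination with a third field. -/
theorem norm_sq_mul_form (X Y : ellipticFields) (x : Plane) :
    ‖x‖ ^ 2 * (Ω X Y : Plane → ℝ) x =
      inner ℝ x ((X : Plane → Plane) x) * (Ω eulerField Y : Plane → ℝ) x +
      inner ℝ (quarterTurn x) ((X : Plane → Plane) x) * (Ω rotationField Y : Plane → ℝ) x := by
  have hX := contDiff_ellipticField X
  let n : smoothFunctions := ⟨fun x => ‖x‖ ^ 2, (contDiff_norm_sq ℝ : ContDiff ℝ ∞ _)⟩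
  let p : smoothFunctions := ⟨fun x => inner ℝ x ((X : Plane → Plane) x), contDiff_id.inner ℝ hX⟩
  let q : smoothFunctions := ⟨fun x => inner ℝ (quarterTurn x) ((X : Plane → Plane) x),
    quarterTurn.contDiff.inner ℝ hX⟩
  -- The factor r² clears denominators, so the decomposition holds among elliptic fields on the
  -- whole plane and Ω can be applied to it.
  have e : (n • X : ellipticFields) =
      (p • eulerField : ellipticFields) + (q • rotationField : ellipticFields) := by
    refine Subtype.ext (funext fun x => ?_)
    change ‖x‖ ^ 2 • (X : Plane → Plane) x = inner ℝ x ((X : Plane → Plane) x) • x +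
      inner ℝ (quarterTurn x) ((X : Plane → Plane) x) • quarterTurn x
    ext i
    fin_cases i <;>
    · simp [Plane.inner_eq, Plane.norm_sq_eq, quarterTurn_apply_zero, quarterTurn_apply_one]
      ring
  have h := congrArg (fun Z => (Ω Z Y : Plane → ℝ) x) e
  simp only [map_add, map_smul] at h
  exact h

theorem IsEllipticSymplectic.swap (hΩ : IsEllipticSymplectic Ω) (X Y : ellipticFields)
    (x : Plane) : (Ω X Y : Plane → ℝ) x = -(Ω Y X : Plane → ℝ) x := by
  have h := hΩ.alternating (X + Y)
  simp only [map_add, LinearMap.add_apply, hΩ.alternating, zero_add, add_zero] at h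
  exact congrFun (congrArg Subtype.val (eq_neg_of_add_eq_zero_right h)) x

theorem IsEllipticSymplectic.norm_sq_mul_form_euler (hΩ : IsEllipticSymplectic Ω)
    (X : ellipticFields) (x : Plane) : ‖x‖ ^ 2 * (Ω X eulerField : Plane → ℝ) x =
      -(inner ℝ (quarterTurn x) ((X : Plane → Plane) x) *
        (Ω eulerField rotationField : Plane → ℝ) x) := by
  rw [norm_sq_mul_form, hΩ.alternating, hΩ.swap rotationField eulerField]
  simp

theorem IsEllipticSymplectic.norm_sq_mul_form_rotation (hΩ : IsEllipticSymplectic Ω)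
    (X : ellipticFields) (x : Plane) : ‖x‖ ^ 2 * (Ω X rotationField : Plane → ℝ) x =
      inner ℝ x ((X : Plane → Plane) x) * (Ω eulerField rotationField : Plane → ℝ) x := by
  rw [norm_sq_mul_form, hΩ.alternating]
  simp

/-- An elliptic symplectic form does not vanish on the Euler and the rotational field. -/
theorem IsEllipticSymplectic.form_euler_rotation_ne_zero (hΩ : IsEllipticSymplectic Ω)
    (x : Plane) : (Ω eulerField rotationField : Plane → ℝ) x ≠ 0 := by
  obtain ⟨l, hl⟩ := exists_radial_functional
  -- Surjectivity of Ω represents the radial functional by a field Z. Since Ω(Z,E) = 1, the product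
  -- ⟨Jx,Z⟩u equals -r², with J the quarter turn. This settles the points off the origin.
  obtain ⟨Z, rfl⟩ := hΩ.nondegenerate.2 l
  have hE : ∀ x, x ≠ 0 → (Ω Z eulerField : Plane → ℝ) x = 1 := fun x hx => by
    refine mul_left_cancel₀ (norm_sq_ne_zero hx) ((hl eulerField x).symm.trans ?_)
    rw [mul_one]
    exact real_inner_self_eq_norm_sq x
  have hZ : ∀ x, x ≠ 0 → inner ℝ (quarterTurn x) ((Z : Plane → Plane) x) *
      (Ω eulerField rotationField : Plane → ℝ) x = -‖x‖ ^ 2 := fun x hx => by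
    have h := hΩ.norm_sq_mul_form_euler Z x
    rw [hE x hx] at h
    linear_combination h
  have hZs := contDiff_ellipticField Z
  have hu := smoothFunctions_contDiff (Ω eulerField rotationField)
  generalize (Ω eulerField rotationField : Plane → ℝ) = u at hZ hu ⊢
  by_cases hx : x = 0
  · subst hx
    intro hu0
    have hcoord : ∀ i, ContDiff ℝ ∞ fun x => (Z : Plane → Plane) x i := fun i =>
      (EuclideanSpace.proj i : Plane →L[ℝ] ℝ).contDiff.comp hZs
    have hline : ∀ i, ContDiff ℝ ∞ fun τ : ℝ => τ • frame i := fun i =>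
      contDiff_id.smul contDiff_const
    -- On the second axis, ⟨x,Z⟩ = r²Ω(Z,Z) divided by τ shows that this component of Z is O(τ).
    have hz0 : (Z : Plane → Plane) 0 1 = 0 := by
      have h₁ : Continuous fun τ : ℝ => (Z : Plane → Plane) (τ • frame 1) 1 :=
        ((hcoord 1).comp (hline 1)).continuous
      have h₂ : Continuous fun τ : ℝ => τ * (Ω Z Z : Plane → ℝ) (τ • frame 1) :=
        continuous_id.mul ((smoothFunctions_contDiff _).comp (hline 1)).continuous
      have h := h₁.ext_on (dense_compl_singleton (0 : ℝ)) h₂ fun τ hτ => by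
        have h := hl Z (τ • frame 1)
        rw [Plane.inner_eq, Plane.norm_sq_eq] at h
        simp [frame] at h
        refine mul_left_cancel₀ (show τ ≠ 0 from hτ) ?_
        simp only [frame]
        linear_combination h
      simpa using congrFun h 0
    have h₁ := ((hcoord 1).comp (hline 0)).differentiable (by simp) 0
    have h₂ := (hu.comp (hline 0)).differentiable (by simp) 0
    -- On the first axis ⟨Jx,Z⟩u = -r² becomes, after division by τ, Z₁u = -τ, with Z₁ the component
    -- indexed by 1. If u(0) = 0, both factors vanish at τ = 0, so the product has derivative 0
    -- rather than -1.
    have h₃ : (fun τ : ℝ => (Z : Plane → Plane) (τ • frame 0) 1 * u (τ • frame 0)) =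
        fun τ => -τ := by
      refine Continuous.ext_on (dense_compl_singleton (0 : ℝ))
        (((hcoord 1).comp (hline 0)).mul (hu.comp (hline 0))).continuous continuous_neg
        fun τ hτ => ?_
      have hτ' : τ ≠ 0 := hτ
      have h := hZ (τ • frame 0) (by simpa [frame] using hτ')
      rw [Plane.inner_eq, Plane.norm_sq_eq, quarterTurn_apply_zero, quarterTurn_apply_one] at h
      simp [frame] at h
      refine mul_left_cancel₀ hτ' ?_
      simp only [frame]
      linear_combination h
    have h₄ := h₁.hasDerivAt.mul h₂.hasDerivAt
    have h₅ := (h₄.congr_of_eventuallyEq (.of_forall fun τ => (congrFun h₃ τ).symm)).unique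
      (hasDerivAt_neg 0)
    simp [hz0, hu0] at h₅
  · intro h
    have h' := hZ x hx
    rw [h, mul_zero, zero_eq_neg] at h'
    exact norm_sq_ne_zero hx h'

/-- Elliptic Poisson structures on the plane are those of the form `r² c ∂₁ ∧ ∂₂` with `c`
nowhere zero. -/
theorem IsEllipticPoisson.exists_eq {P : Plane → (Plane →L[ℝ] ℝ) →L[ℝ] Plane}
    (hP : IsEllipticPoisson P) : ∃ c : Plane → ℝ, ContDiff ℝ ∞ c ∧ (∀ x, c x ≠ 0) ∧
      ∀ x ξ, P x ξ = (‖x‖ ^ 2 * c x) • standardSharp ξ := by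
  obtain ⟨Ω, hΩ, hP⟩ := hP
  have hu := hΩ.form_euler_rotation_ne_zero
  have hus := smoothFunctions_contDiff (Ω eulerField rotationField)
  refine ⟨fun x => ((Ω eulerField rotationField : Plane → ℝ) x)⁻¹, hus.inv hu,
    fun x => inv_ne_zero (hu x), fun x ξ => ?_⟩
  -- Constant one-forms suffice, since `P x` acts on single covectors.
  obtain ⟨X, hX, hPX⟩ := hP (fun _ => ξ) contDiff_const
  have hc : ContDiff ℝ ∞ fun x : Plane =>
      (‖x‖ ^ 2 * ((Ω eulerField rotationField : Plane → ℝ) x)⁻¹) • standardSharp ξ :=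
    ((contDiff_id.norm_sq ℝ).mul (hus.inv hu)).smul contDiff_const
  rw [hPX x]
  refine congrFun (eq_of_eq_off_origin (contDiff_ellipticField X).continuous hc.continuous
    fun x hx => ?_) x
  have hn := norm_sq_ne_zero hx
  have h₁ := hΩ.norm_sq_mul_form_euler X x
  have h₂ := hΩ.norm_sq_mul_form_rotation X x
  rw [hX] at h₁ h₂
  change ‖x‖ ^ 2 * ξ x = _ at h₁
  change ‖x‖ ^ 2 * ξ (quarterTurn x) = _ at h₂
  have hux := hu x
  generalize (Ω eulerField rotationField : Plane → ℝ) x = u at h₁ h₂ hux ⊢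
  rw [Plane.map_eq ξ x, Plane.inner_eq, quarterTurn_apply_zero, quarterTurn_apply_one] at h₁
  rw [Plane.map_eq ξ (quarterTurn x), Plane.inner_eq, quarterTurn_apply_zero,
    quarterTurn_apply_one] at h₂
  simp only [smul_eq_mul] at h₁ h₂
  -- The pairings with E and R form a linear system for X in the orthogonal basis x, Jx; these
  -- combinations invert it.
  have k₀ : (X : Plane → Plane) x 0 * u = ‖x‖ ^ 2 * ξ (frame 1) := mul_left_cancel₀ hn (by
    rw [Plane.norm_sq_eq] at *
    linear_combination -(x 0 * h₂ + x 1 * h₁))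
  have k₁ : (X : Plane → Plane) x 1 * u = -(‖x‖ ^ 2 * ξ (frame 0)) := mul_left_cancel₀ hn (by
    rw [Plane.norm_sq_eq] at *
    linear_combination x 0 * h₁ - x 1 * h₂)
  ext i
  fin_cases i
  · simp only [Fin.zero_eta, PiLp.smul_apply, standardSharp_apply_zero, smul_eq_mul]
    field_simp
    exact k₀
  · simp only [Fin.mk_one, PiLp.smul_apply, standardSharp_apply_one, smul_eq_mul]
    field_simp
    exact k₁

end EllipticGroupoid

end

theorem mainTheorem11 :
    ∃ 𝒢 : EllipticGroupoid.LieGroupoid EllipticGroupoid.arrows EllipticGroupoid.Plane,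
      EllipticGroupoid.ExtendsPairGroupoid 𝒢 ∧
      (∀ 𝒢' : EllipticGroupoid.LieGroupoid EllipticGroupoid.arrows EllipticGroupoid.Plane,
        EllipticGroupoid.ExtendsPairGroupoid 𝒢' → 𝒢' = 𝒢) ∧
      (∀ g : EllipticGroupoid.arrows, 𝒢.src g = g.1.1 + ‖g.1.1‖ ^ 2 • g.1.2) ∧
      (∀ g : EllipticGroupoid.arrows, 𝒢.tgt g = g.1.1) ∧
      𝒢.Integrates EllipticGroupoid.spanAnchor EllipticGroupoid.spanBracket ∧
      ∀ P : EllipticGroupoid.Plane →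
          (EllipticGroupoid.Plane →L[ℝ] ℝ) →L[ℝ] EllipticGroupoid.Plane,
        EllipticGroupoid.IsEllipticPoisson P →
          𝒢.Integrates P (EllipticGroupoid.cotangentBracket P) := by
  refine ⟨EllipticGroupoid.blowUpGroupoid, EllipticGroupoid.extendsPairGroupoid_blowUpGroupoid,
    fun _ h => h.eq_blowUpGroupoid, fun _ => rfl, fun _ => rfl, EllipticGroupoid.integrates_span,
    fun P hP => ?_⟩
  obtain ⟨c, hc, h0, h⟩ := hP.exists_eq
  exact EllipticGroupoid.integrates_cotangent hc h0 h
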